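/- Let $P$ and $Q$ be lattice paths from $(0,0)$ to $(m,r)$, with steps $E=(1,0)$ and $N=(0,1)$, such that $P$ never goes above $Q$. Let $u_1<\dots<u_r$ and $l_1<\dots<l_r$ be the positions of the north steps of $P$ and of $Q$, and let $M[P,Q]$ be the transversal matroid on $[m+r]$ with presentation $([l_k,u_k] : k=1,\dots,r)$, i.e. its independent sets are the partial transversals of this family of intervals. A *lattice path matroid* is a matroid isomorphic to some $M[P,Q]$. The polytope $\mathcal P(M)$ of a matroid $M$ is the convex hull of the incidence vectors of its bases; if $M$ has ground set $E\subseteq[n]$, we regard $\mathcal P(M)\subseteq\mathbb R^E$ as a subset of $\mathbb R^n$ by setting the coordinates outside $E$ to $0$. Let $p_i$ and $q_i$ be the numbers of north steps among the first $i$ steps of $P$ and of $Q$. Then: 1. Let $M$ be a lattice path matroid with ground set $E\subseteq[n]$. Every nonempty face of $\mathcal P(M)$ (that is, every nonempty set of maximizers on $\mathcal P(M)$ of a linear functional) is equal to $\mathcal P(N)$ for some lattice path matroid $N$ with ground set $E$. 2. Let $P$ and $Q$ be as above, let $0\le i\le m+r$ and $c\in\{p_i,q_i\}$. Then $F=\mathcal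 P(M[P,Q])\cap\{x_1+\dots+x_i=c\}$ is a nonempty face of $\mathcal P(M[P,Q])$, and there are lattice path matroids $N_1$ on $\{1,\dots,i\}$ and $N_2$ on $\{i+1,\dots,m+r\}$ such that $N_1\oplus N_2$ is a lattice path matroid and $F=\mathcal P(N_1\oplus N_2)=\mathcal P(N_1)+\mathcal P(N_2)$. 3. Let $M$ be a lattice path matroid with ground set $E\subseteq[n]$, and let $i\in E$. Then the deletion $M\setminus i$ and the contraction $M/i$ are lattice path matroids. The set $\mathcal P(M)\cap\{x_i=0\}$ is a (possibly empty) face of $\mathcal P(M)$; it is nonempty if and only if $i$ is not a coloop of $M$, and in that case it equals $\mathcal P(M\setminus i)$. The set $\mathcal P(M)\cap\{x_i=1\}$ is a (possibly empty) face of $\mathcal P(M)$; it is nonempty if and only if $i$ is not a loop of $M$, and in that case it equals $e_i+\mathcal P(M/i)$, where $e_i$ is the $i$-th standard basis vector. -/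

import Mathlib

open Set
open scoped Matroid Pointwise

/-! ### Transversal matroids -/

section Transversal

variable {α ι : Type*}

/-- `T` is a transversal of the set system `A`: it consists of distinct elements `x j ∈ A j`, one
for each index `j`. -/
def IsTransversal (A : ι → Set α) (T : Set α) : Prop :=
  ∃ x : ι → α, Function.Injective x ∧ (∀ j, x j ∈ A j) ∧ range x = T

/-- A partial transversal of `A` is a transversal of a subsystem of `A`. -/
def IsPartialTransversal (A : ι → Set α) (T : Set α) : Prop :=
  ∃ K : Set ι, IsTransversal (fun k : K => A k) T

theorem isPartialTransversal_iff (A : ι → Set α) (T : Set α) :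
    IsPartialTransversal A T ↔
      ∃ f : T → ι, Function.Injective f ∧ ∀ t : T, (t : α) ∈ A (f t) := by
  constructor
  · rintro ⟨K, x, hx, hA, rfl⟩
    choose g hg using fun t : range x => t.2
    refine ⟨fun t => (g t : ι), fun s t h => ?_, fun t => ?_⟩
    · have h' : g s = g t := Subtype.ext h
      exact Subtype.ext (by rw [← hg s, ← hg t, h'])
    · have := hA (g t)
      rwa [hg t] at this
  · rintro ⟨f, hf, hA⟩
    choose g hg using fun k : range f => k.2
    refine ⟨range f, fun k => (g k : α), fun k l h => ?_, fun k => ?_, ?_⟩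
    · have h' : g k = g l := Subtype.ext h
      exact Subtype.ext (by rw [← hg k, ← hg l, h'])
    · have := hA (g k)
      rwa [hg k] at this
    · ext t
      constructor
      · rintro ⟨k, rfl⟩
        exact (g k).2
      · intro ht
        exact ⟨⟨f ⟨t, ht⟩, mem_range_self _⟩,
          congrArg Subtype.val (hf (hg ⟨f ⟨t, ht⟩, mem_range_self _⟩))⟩

theorem IsPartialTransversal.subset {A : ι → Set α} {I J : Set α}
    (hJ : IsPartialTransversal A J) (hIJ : I ⊆ J) : IsPartialTransversal A I := by
  rw [isPartialTransversal_iff] at hJ ⊢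
  obtain ⟨f, hf, hA⟩ := hJ
  exact ⟨fun t => f ⟨t, hIJ t.2⟩, fun s t h => Subtype.ext (Subtype.mk.inj (hf h)),
    fun t => hA ⟨t, hIJ t.2⟩⟩

open Classical in
/-- Augmentation, by choosing matchings of the two sets that agree as often as possible. -/
theorem IsPartialTransversal.augment [Finite α] {A : ι → Set α} {I J : Set α}
    (hI : IsPartialTransversal A I) (hJ : IsPartialTransversal A J) (hIJ : I.ncard < J.ncard) :
    ∃ e ∈ J, e ∉ I ∧ IsPartialTransversal A (insert e I) := by
  have := Fintype.ofFinite α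
  simp only [isPartialTransversal_iff] at hI hJ ⊢
  obtain ⟨g, hg, hgA⟩ := hJ
  have key : ∀ n : ℕ, ∀ f : I → ι, Function.Injective f → (∀ t : I, (t : α) ∈ A (f t)) →
      {t : I | ∀ h : (t : α) ∈ J, f t ≠ g ⟨t, h⟩}.ncard = n →
      ∃ e ∈ J, e ∉ I ∧ ∃ f : ↥(insert e I) → ι,
        Function.Injective f ∧ ∀ t : ↥(insert e I), (t : α) ∈ A (f t) := by
    intro n
    induction n using Nat.strong_induction_on with
    | _ n ih =>
      intro f hf hA hn
      obtain ⟨j, hj⟩ : ∃ j : J, g j ∉ range f := by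
        by_contra hcon
        push Not at hcon
        have h1 : (range g).ncard ≤ (range f).ncard :=
          ncard_le_ncard (by rintro _ ⟨j, rfl⟩; exact hcon j) (finite_range f)
        rw [← image_univ, ← image_univ, ncard_image_of_injective _ hg,
          ncard_image_of_injective _ hf, ncard_univ, ncard_univ] at h1
        exact absurd hIJ (not_lt.2 h1)
      by_cases hjI : (j : α) ∈ I
      · set j' : I := ⟨j, hjI⟩ with hj'
        refine ih _ ?_ (Function.update f j' (g j)) ?_ ?_ rfl
        · rw [← hn]
          refine ncard_lt_ncard ⟨?_, fun hsub => ?_⟩ (toFinite _)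
          · intro t ht h
            have htj : t ≠ j' := by
              rintro rfl
              exact ht j.2 (by simp [hj'])
            have := ht h
            rwa [Function.update_of_ne htj] at this
          · have hmem : j' ∈ {t : I | ∀ h : (t : α) ∈ J, f t ≠ g ⟨t, h⟩} :=
              fun h heq => hj ⟨j', heq⟩
            exact hsub hmem j.2 (by simp [hj'])
        · intro s t hst
          by_cases hs : s = j' <;> by_cases ht : t = j'
          · rw [hs, ht]
          · rw [hs, Function.update_self, Function.update_of_ne ht] at hst
            exact absurd ⟨t, hst.symm⟩ hj
          · rw [ht, Function.update_self, Function.update_of_ne hs] at hst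
            exact absurd ⟨s, hst⟩ hj
          · rw [Function.update_of_ne hs, Function.update_of_ne ht] at hst
            exact hf hst
        · intro t
          by_cases ht : t = j'
          · rw [ht, Function.update_self]
            exact hgA j
          · rw [Function.update_of_ne ht]
            exact hA t
      · refine ⟨j, j.2, hjI, fun t => if h : (t : α) ∈ I then f ⟨t, h⟩ else g j, ?_, ?_⟩
        · intro s t hst
          have hins : ∀ u : ↥(insert (j : α) I), (u : α) ∉ I → (u : α) = j :=
            fun u hu => u.2.resolve_right hu
          by_cases hs : (s : α) ∈ I <;> by_cases ht : (t : α) ∈ I <;>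
            simp only [hs, ht, dif_pos, dif_neg, not_false_eq_true] at hst
          · exact Subtype.ext (congrArg (fun u : I => (u : α)) (hf hst))
          · exact absurd ⟨_, hst⟩ hj
          · exact absurd ⟨_, hst.symm⟩ hj
          · exact Subtype.ext ((hins s hs).trans (hins t ht).symm)
        · intro t
          by_cases ht : (t : α) ∈ I
          · simp only [ht, dif_pos]
            exact hA ⟨t, ht⟩
          · have : (t : α) = j := t.2.resolve_right ht
            simp only [ht, dif_neg, not_false_eq_true]
            rw [this]
            exact hgA j
  obtain ⟨f, hf, hA⟩ := hI
  exact key _ f hf hA rfl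

/-- The transversal matroid with presentation `A`: its ground set is all of the finite type `α` and
its independent sets are the partial transversals of `A`. -/
def transversalMatroid [Finite α] (A : ι → Set α) : Matroid α :=
  (IndepMatroid.ofFinite (E := univ) finite_univ (IsPartialTransversal A)
    ((isPartialTransversal_iff A ∅).2 ⟨fun t => t.2.elim, fun t => t.2.elim, fun t => t.2.elim⟩)
    (fun _ _ hJ hIJ => hJ.subset hIJ)
    (fun _ _ hI hJ hIJ => hI.augment hJ hIJ)
    (fun _ _ => subset_univ _)).matroid

end Transversal

/-! ### Lattice paths and their matroids -/

/-- The two kinds of steps, `(1,0)` and `(0,1)`. -/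
inductive LatticeStep
  | east
  | north
  deriving DecidableEq

/-- A lattice path from `(0,0)` to `(m,r)`: a word of length `m + r` in the east and north steps,
exactly `r` of which are north. The `(k+1)`-st step is `step k` (`k = 0, …, m + r - 1`). -/
structure LatticePath (m r : ℕ) where
  step : Fin (m + r) → LatticeStep
  card_north : (Finset.univ.filter fun k => step k = LatticeStep.north).card = r

namespace LatticePath

variable {m r : ℕ}

/-- The positions of the north steps. -/
def northSteps (P : LatticePath m r) : Finset (Fin (m + r)) :=
  Finset.univ.filter fun k => P.step k = LatticeStep.north

/-- The position of the `k`-th north step; the north steps are listed in increasing order. -/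
def northPos (P : LatticePath m r) (k : Fin r) : Fin (m + r) :=
  P.northSteps.orderEmbOfFin P.card_north k

/-- The number of north steps among the first `i` steps; after `i` steps the path is at the point
`(i - P.height i, P.height i)`. -/
def height (P : LatticePath m r) (i : ℕ) : ℕ :=
  (P.northSteps.filter fun k : Fin (m + r) => (k : ℕ) < i).card

/-- `P` never goes above `Q`. -/
def NeverAbove (P Q : LatticePath m r) : Prop :=
  ∀ i : ℕ, i ≤ m + r → P.height i ≤ Q.height i

/-- The matroid `M[P, Q]`, presented by the intervals between the `k`-th north step of `Q` and the
`k`-th north step of `P`. -/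
def matroid (P Q : LatticePath m r) : Matroid (Fin (m + r)) :=
  transversalMatroid fun k : Fin r => Icc (Q.northPos k) (P.northPos k)

end LatticePath

/-- Two matroids are isomorphic if some bijection between their ground sets preserves independence
in both directions. -/
def MatroidIsomorphic {α β : Type*} (M : Matroid α) (N : Matroid β) : Prop :=
  ∃ e : M.E ≃ N.E, ∀ I : Set M.E,
    M.Indep (Subtype.val '' I) ↔ N.Indep (Subtype.val '' (e '' I))

/-- A lattice path matroid is a matroid isomorphic to some `M[P, Q]`. -/
def IsLatticePathMatroid {α : Type*} (M : Matroid α) : Prop :=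
  ∃ (m r : ℕ) (P Q : LatticePath m r), P.NeverAbove Q ∧ MatroidIsomorphic (P.matroid Q) M

/-- The matroid polytope: the convex hull of the incidence vectors of the bases. For a matroid whose
ground set `E` is a proper subset of `α`, the space `ℝ^E` is regarded as the coordinate subspace of
`ℝ^α` where the coordinates outside `E` vanish. -/
def matroidPolytope {α : Type*} (M : Matroid α) : Set (α → ℝ) :=
  convexHull ℝ ((fun B : Set α => B.indicator (1 : α → ℝ)) '' {B | M.IsBase B})

/-! The bases of `P.matroid Q` are the sets whose prefix counts lie between the heights of `P` and
`Q` (`LatticePath.NeverAbove.isBase_iff`). For closure arguments a looser description is better: a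
corridor matroid bounds the prefix counts along some linear order by arbitrary integers. Replacing
those bounds by the minimum and maximum over all bases gives two genuine paths, so corridor matroids
are exactly the lattice path matroids. Minors and direct sums then amount to editing the bounds.

A linear functional restricted to incidence vectors of bases is a weight function, so a face is the
hull of the bases of maximal weight. If `S` is the set of heaviest elements, such a base is a basis
of `S` together with a maximal weight base of `M ／ S`. Induction on the ground set, with closure
under restriction, contraction and direct sum, shows that these bases form a lattice path matroid
(`IsLatticePathMatroid.exists_isBase_iff_setWeight_max`).

The faces at prefix sums come from the same splitting into `M ↾ S` and `M ／ S`, with `S` a prefix or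
a suffix. For coordinate faces one selects the bases avoiding or containing an element. -/

/-! ### Prefix counts of finite sets -/

section PrefixCount

variable {n r : ℕ}

/-- The number of elements of `B` among the first `i` elements of `Fin n`. -/
def prefixCount (B : Finset (Fin n)) (i : ℕ) : ℕ := (B.filter fun k : Fin n => (k : ℕ) < i).card

theorem prefixCount_eq_card_orderEmbOfFin (B : Finset (Fin n)) (h : B.card = r) (i : ℕ) :
    prefixCount B i = (Finset.univ.filter fun k : Fin r => (B.orderEmbOfFin h k : ℕ) < i).card := by
  unfold prefixCount
  conv_lhs => rw [← B.map_orderEmbOfFin_univ h]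
  rw [Finset.filter_map, Finset.card_map]
  rfl

theorem prefixCount_of_le (B : Finset (Fin n)) {i : ℕ} (hi : n ≤ i) : prefixCount B i = B.card := by
  unfold prefixCount
  rw [Finset.filter_true_of_mem fun k _ => k.2.trans_le hi]

theorem prefixCount_zero (B : Finset (Fin n)) : prefixCount B 0 = 0 := by
  simp [prefixCount]

theorem prefixCount_succ (B : Finset (Fin n)) (k : Fin n) :
    prefixCount B (k + 1) = prefixCount B k + if k ∈ B then 1 else 0 := by
  unfold prefixCount
  have h : (B.filter fun j : Fin n => (j : ℕ) < k + 1) =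
      (B.filter fun j : Fin n => (j : ℕ) < k) ∪ (B.filter fun j => j = k) := by
    ext j
    simp only [Finset.mem_filter, Finset.mem_union, Fin.ext_iff]
    grind
  rw [h, Finset.card_union_of_disjoint]
  · congr 1
    rw [Finset.filter_eq']
    split <;> simp
  · rw [Finset.disjoint_left]
    intro j hj hj'
    simp only [Finset.mem_filter, Fin.ext_iff] at hj hj'
    omega

theorem prefixCount_mono (B : Finset (Fin n)) : Monotone (prefixCount B) := fun _ _ hij =>
  Finset.card_le_card (Finset.monotone_filter_right _ fun _ _ h => lt_of_lt_of_le h hij)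

theorem prefixCount_succ_le (B : Finset (Fin n)) (i : ℕ) :
    prefixCount B (i + 1) ≤ prefixCount B i + 1 := by
  rcases lt_or_ge i n with hi | hi
  · have := prefixCount_succ B ⟨i, hi⟩
    simp only at this
    split at this <;> omega
  · rw [prefixCount_of_le _ hi, prefixCount_of_le _ (hi.trans i.le_succ)]
    omega

/-- Every function that climbs by unit steps from `0` counts the elements of prefixes. -/
theorem exists_prefixCount_eq (h : ℕ → ℕ) (h0 : h 0 = 0) (hmono : Monotone h)
    (hstep : ∀ i, h (i + 1) ≤ h i + 1) :
    ∃ B : Finset (Fin n), ∀ i ≤ n, prefixCount B i = h i := by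
  refine ⟨Finset.univ.filter fun k : Fin n => h (k + 1) = h k + 1, fun i => ?_⟩
  induction i with
  | zero => intro _; rw [prefixCount_zero, h0]
  | succ i ih =>
    intro hi
    have := prefixCount_succ (Finset.univ.filter fun k : Fin n => h (k + 1) = h k + 1) ⟨i, hi⟩
    simp only [Finset.mem_filter, Finset.mem_univ, true_and] at this
    rw [this, ih (by omega)]
    have h1 := hmono (Nat.le_succ i)
    have h2 := hstep i
    simp only [Nat.succ_eq_add_one] at h1
    split <;> omega

/-- If the `k`-th element of `C` came strictly before that of `B`, the prefix ending at it would
contain at least `k + 1` elements of `C` but at most `k` of `B` (counting `k` from zero). -/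
theorem orderEmbOfFin_le_of_prefixCount_le {B C : Finset (Fin n)} (hB : B.card = r)
    (hC : C.card = r) (h : ∀ i, prefixCount C i ≤ prefixCount B i) (k : Fin r) :
    B.orderEmbOfFin hB k ≤ C.orderEmbOfFin hC k := by
  by_contra! hlt
  have h1 := h (C.orderEmbOfFin hC k + 1)
  rw [prefixCount_eq_card_orderEmbOfFin C hC, prefixCount_eq_card_orderEmbOfFin B hB] at h1
  have h2 : (Finset.Iic k).card ≤
      (Finset.univ.filter fun j => (C.orderEmbOfFin hC j : ℕ) < C.orderEmbOfFin hC k + 1).card :=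
    Finset.card_le_card fun j hj => by
      simpa [Nat.lt_succ_iff] using hj
  have h3 : (Finset.univ.filter fun j =>
      (B.orderEmbOfFin hB j : ℕ) < C.orderEmbOfFin hC k + 1).card ≤ (Finset.Iio k).card :=
    Finset.card_le_card fun j hj => by
      have : B.orderEmbOfFin hB j ≤ C.orderEmbOfFin hC k := by
        simpa [Nat.lt_succ_iff] using hj
      simpa using this.trans_lt hlt
  rw [Fin.card_Iic] at h2
  rw [Fin.card_Iio] at h3
  omega

end PrefixCount

/-! ### Bases of `P.matroid Q` through path heights -/

section Transversal

variable {α : Type*}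

theorem IsPartialTransversal.ncard_le {r : ℕ} {A : Fin r → Set α} {T : Set α}
    (h : IsPartialTransversal A T) : T.ncard ≤ r := by
  obtain ⟨f, hf, -⟩ := (isPartialTransversal_iff A T).1 h
  have := Nat.card_le_card_of_injective f hf
  simpa using this

theorem transversalMatroid_indep_iff [Finite α] {ι : Type*} {A : ι → Set α} {I : Set α} :
    (transversalMatroid A).Indep I ↔ IsPartialTransversal A I := Iff.rfl

theorem transversalMatroid_ground [Finite α] {ι : Type*} {A : ι → Set α} :
    (transversalMatroid A).E = univ := rfl

theorem isBase_transversalMatroid_of_ncard_eq [Finite α] {r : ℕ} {A : Fin r → Set α} {T : Set α}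
    (h : IsPartialTransversal A T) (hT : T.ncard = r) : (transversalMatroid A).IsBase T := by
  obtain ⟨B, hB, hTB⟩ := (transversalMatroid_indep_iff.2 h).exists_isBase_superset
  have h1 := (transversalMatroid_indep_iff.1 hB.indep).ncard_le
  rwa [eq_of_subset_of_ncard_le hTB (by omega) (toFinite B)]

end Transversal

namespace LatticePath

variable {m r : ℕ} {P Q : LatticePath m r}

theorem height_eq_prefixCount (P : LatticePath m r) (i : ℕ) :
    P.height i = prefixCount P.northSteps i := rfl

theorem height_eq_card_northPos (P : LatticePath m r) (i : ℕ) :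
    P.height i = (Finset.univ.filter fun k : Fin r => (P.northPos k : ℕ) < i).card :=
  prefixCount_eq_card_orderEmbOfFin _ _ _

theorem height_of_le (P : LatticePath m r) {i : ℕ} (hi : m + r ≤ i) : P.height i = r :=
  (prefixCount_of_le _ hi).trans P.card_north

theorem NeverAbove.height_le (h : P.NeverAbove Q) (i : ℕ) : P.height i ≤ Q.height i := by
  rcases le_total i (m + r) with hi | hi
  · exact h i hi
  · rw [P.height_of_le hi, Q.height_of_le hi]

theorem isBase_of_height_le {B : Finset (Fin (m + r))}
    (hB : ∀ i, P.height i ≤ prefixCount B i ∧ prefixCount B i ≤ Q.height i) :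
    (P.matroid Q).IsBase (B : Set (Fin (m + r))) := by
  have hcard : B.card = r := by
    have := hB (m + r)
    rw [P.height_of_le le_rfl, Q.height_of_le le_rfl, prefixCount_of_le _ le_rfl] at this
    omega
  refine isBase_transversalMatroid_of_ncard_eq
    ⟨univ, fun k => B.orderEmbOfFin hcard k, fun i j hij => ?_, fun k => ⟨?_, ?_⟩, ?_⟩ (by simpa)
  · exact Subtype.ext ((B.orderEmbOfFin hcard).injective hij)
  · exact orderEmbOfFin_le_of_prefixCount_le _ _ (fun i => (hB i).2) _
  · exact orderEmbOfFin_le_of_prefixCount_le _ _ (fun i => (hB i).1) _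
  · rw [← B.range_orderEmbOfFin hcard]
    ext x
    simp only [mem_range, Subtype.exists, mem_univ, exists_const]

/-- A base has `r` elements, so its matching is a bijection with the intervals. An interval that
ends before `i` forces its partner before `i`, and an element before `i` forces its interval to
start before `i`; these give the two bounds. Conversely, the `k`-th element of a set obeying the
bounds lies in the `k`-th interval. -/
theorem NeverAbove.isBase_iff (hPQ : P.NeverAbove Q) {B : Finset (Fin (m + r))} :
    (P.matroid Q).IsBase (B : Set (Fin (m + r))) ↔
      ∀ i, P.height i ≤ prefixCount B i ∧ prefixCount B i ≤ Q.height i := by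
  refine ⟨fun hB => ?_, isBase_of_height_le⟩
  have hP : (P.matroid Q).IsBase (P.northSteps : Set (Fin (m + r))) :=
    isBase_of_height_le fun i => ⟨le_rfl, hPQ.height_le i⟩
  have hcard : B.card = r := by
    have := hB.ncard_eq_ncard_of_isBase hP
    rw [ncard_coe_finset, ncard_coe_finset] at this
    exact this.trans P.card_north
  obtain ⟨f, hf, hA⟩ := (isPartialTransversal_iff _ _).1 (transversalMatroid_indep_iff.1 hB.indep)
  have hbij : Function.Bijective f := by
    rw [Fintype.bijective_iff_injective_and_card]
    exact ⟨hf, by simpa using hcard⟩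
  intro i
  rw [P.height_eq_card_northPos, Q.height_eq_card_northPos]
  choose g hg using hbij.2
  constructor
  · refine Finset.card_le_card_of_injOn (fun k => (g k : Fin (m + r))) (fun k hk => ?_)
      fun k _ l _ hkl => ?_
    · have h1 := (hA (g k)).2
      rw [hg] at h1
      simp only [Finset.coe_filter, Finset.mem_univ, true_and, mem_ofPred_eq] at hk ⊢
      exact ⟨(g k).2, lt_of_le_of_lt h1 hk⟩
    · rw [← hg k, ← hg l, Subtype.ext hkl]
  · refine (Finset.card_le_card fun x hx => ?_).trans
      (Finset.card_image_le (f := fun k => (g k : Fin (m + r))))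
    rw [Finset.mem_filter] at hx
    have h1 := (hA ⟨x, hx.1⟩).1
    refine Finset.mem_image.2 ⟨f ⟨x, hx.1⟩, ?_, congrArg Subtype.val (hf (hg _))⟩
    rw [Finset.mem_filter]
    exact ⟨Finset.mem_univ _, lt_of_le_of_lt h1 hx.2⟩

end LatticePath

namespace LatticePath

variable {m r : ℕ}

open Classical in
/-- The lattice path with a prescribed set of north steps. -/
noncomputable def ofNorthSteps (B : Finset (Fin (m + r))) (h : B.card = r) : LatticePath m r where
  step k := if k ∈ B then LatticeStep.north else LatticeStep.east
  card_north := by simpa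

theorem northSteps_ofNorthSteps (B : Finset (Fin (m + r))) (h : B.card = r) :
    (ofNorthSteps B h).northSteps = B := by
  ext k
  simp [northSteps, ofNorthSteps]

end LatticePath

/-! ### Corridor matroids are the lattice path matroids -/

section Corridor

variable {α : Type*}

theorem isLatticePathMatroid_iff_exists_map {M : Matroid α} :
    IsLatticePathMatroid M ↔ ∃ (m r : ℕ) (P Q : LatticePath m r) (f : Fin (m + r) → α)
      (hf : Function.Injective f), P.NeverAbove Q ∧ M = (P.matroid Q).map f hf.injOn := by
  constructor
  · rintro ⟨m, r, P, Q, hPQ, e, he⟩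
    refine ⟨m, r, P, Q, fun k => e ⟨k, mem_univ k⟩, fun k l hkl => ?_, hPQ, ?_⟩
    · exact congrArg Subtype.val (e.injective (Subtype.ext hkl))
    have key : ∀ J : Set (P.matroid Q).E, Subtype.val '' (e '' J) =
        (fun k => (e ⟨k, mem_univ k⟩ : α)) '' (Subtype.val '' J) := fun J => by
      simp only [image_image]
    refine Matroid.ext_indep ?_ fun I hI => ?_
    · have := key univ
      rw [image_univ, e.range_eq_univ] at this
      simpa using this
    · obtain ⟨J, rfl⟩ : ∃ J : Set (P.matroid Q).E, Subtype.val '' (e '' J) = I := by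
        refine ⟨e ⁻¹' (Subtype.val ⁻¹' I), ?_⟩
        rw [image_preimage_eq _ e.surjective, Subtype.image_preimage_coe,
          inter_eq_self_of_subset_right hI]
      rw [← he, key, Matroid.map_image_indep_iff (subset_univ _)]
  · rintro ⟨m, r, P, Q, f, hf, hPQ, rfl⟩
    refine ⟨m, r, P, Q, hPQ, Equiv.ofBijective
      (fun k => ⟨f k, mem_image_of_mem f k.2⟩) ⟨fun k l hkl => ?_, ?_⟩, fun I => ?_⟩
    · exact Subtype.ext (hf (Subtype.mk.inj hkl))
    · rintro ⟨_, k, hk, rfl⟩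
      exact ⟨⟨k, hk⟩, rfl⟩
    · rw [← Matroid.map_image_indep_iff (hf := hf.injOn) (subset_univ _)]
      simp only [image_image]
      rfl

/-- A matroid whose bases are the sets whose numbers of elements in the initial segments of some
linear order of the ground set obey lower and upper bounds. -/
def IsCorridorMatroid (M : Matroid α) : Prop :=
  ∃ (pos : α → ℕ) (a b : ℕ → ℤ), InjOn pos M.E ∧ ∀ B ⊆ M.E, M.IsBase B ↔
    ∀ i, a i ≤ ({x ∈ B | pos x < i}.ncard : ℤ) ∧ ({x ∈ B | pos x < i}.ncard : ℤ) ≤ b i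

theorem IsLatticePathMatroid.isCorridorMatroid {M : Matroid α} (h : IsLatticePathMatroid M) :
    IsCorridorMatroid M := by
  classical
  obtain ⟨m, r, P, Q, f, hf, hPQ, rfl⟩ := isLatticePathMatroid_iff_exists_map.1 h
  -- The value `0` off the range of `f` is harmless: positions matter only on the ground set.
  refine ⟨Function.extend f (fun k => (k : ℕ)) 0, fun i => P.height i, fun i => Q.height i,
    ?_, fun B hB => ?_⟩
  · rintro _ ⟨k, -, rfl⟩ _ ⟨l, -, rfl⟩ hkl
    rw [hf.extend_apply, hf.extend_apply] at hkl
    rw [Fin.ext hkl]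
  · obtain ⟨B, -, rfl⟩ := subset_image_iff.1 hB
    lift B to Finset (Fin (m + r)) using toFinite B
    have hcount : ∀ i, {x ∈ f '' (B : Set (Fin (m + r))) |
        Function.extend f (fun k => (k : ℕ)) 0 x < i}.ncard = prefixCount B i := fun i => by
      rw [prefixCount, ← ncard_coe_finset, ← ncard_image_of_injective _ hf]
      congr 1
      ext x
      simp only [mem_image, Finset.coe_filter, mem_ofPred_eq]
      constructor
      · rintro ⟨⟨k, hk, rfl⟩, h⟩
        rw [hf.extend_apply] at h
        exact ⟨k, ⟨hk, h⟩, rfl⟩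
      · rintro ⟨k, ⟨hk, h⟩, rfl⟩
        rw [hf.extend_apply]
        exact ⟨⟨k, hk, rfl⟩, h⟩
    rw [Matroid.map_image_isBase_iff (subset_univ _), hPQ.isBase_iff]
    simp only [hcount, Nat.cast_le]

theorem exists_strictMono_enumeration [Finite α] {S : Set α} {pos : α → ℕ} (hpos : InjOn pos S)
    {n : ℕ} (hn : S.ncard = n) :
    ∃ f : Fin n → α, Function.Injective f ∧ range f = S ∧ StrictMono (pos ∘ f) := by
  classical
  have hfin : (pos '' S).Finite := toFinite _
  have hcard : hfin.toFinset.card = n := by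
    rw [← ncard_eq_toFinset_card _ hfin, hpos.ncard_image, hn]
  have hmem : ∀ k, hfin.toFinset.orderEmbOfFin hcard k ∈ pos '' S := fun k =>
    hfin.mem_toFinset.1 (Finset.orderEmbOfFin_mem _ hcard k)
  choose f hf hpf using hmem
  have hmono : StrictMono (pos ∘ f) := fun k l hkl => by
    simpa only [Function.comp_apply, hpf] using (hfin.toFinset.orderEmbOfFin hcard).strictMono hkl
  refine ⟨f, hmono.injective.of_comp, ?_, hmono⟩
  refine subset_antisymm (range_subset_iff.2 hf) fun x hx => ?_
  have : pos x ∈ range (hfin.toFinset.orderEmbOfFin hcard) := by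
    rw [Finset.range_orderEmbOfFin]
    simpa using ⟨x, hx, rfl⟩
  obtain ⟨k, hk⟩ := this
  exact ⟨k, hpos (hf k) hx ((hpf k).trans hk)⟩

/-- The indices with `g l < i` form an initial segment, which its cardinality determines. This
converts thresholds on positions into thresholds on ranks in the order. -/
theorem lt_iff_lt_card_filter_of_strictMono {n : ℕ} {g : Fin n → ℕ} (hg : StrictMono g) (i : ℕ)
    (k : Fin n) : g k < i ↔ (k : ℕ) < (Finset.univ.filter fun l => g l < i).card := by
  constructor
  · intro h
    rw [← Nat.succ_le_iff, Nat.succ_eq_add_one, ← Fin.card_Iic k]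
    exact Finset.card_le_card fun l hl => by
      simpa using (hg.monotone (Finset.mem_Iic.1 hl)).trans_lt h
  · intro h
    by_contra! hk
    refine h.not_ge ?_
    rw [← Fin.card_Iio k]
    refine Finset.card_le_card fun l hl => ?_
    rw [Finset.mem_Iio, ← hg.lt_iff_lt]
    exact (Finset.mem_filter.1 hl).2.trans_le hk

/-- The given bounds need not be heights of paths. The pointwise minimum and maximum of the prefix
counts of all bases are, and they cut out the same sets. -/
theorem IsCorridorMatroid.isLatticePathMatroid [Finite α] {M : Matroid α}
    (h : IsCorridorMatroid M) : IsLatticePathMatroid M := by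
  classical
  obtain ⟨pos, a, b, hpos, hM⟩ := h
  obtain ⟨B₀, hB₀⟩ := M.exists_isBase
  obtain ⟨m, hm⟩ := Nat.exists_eq_add_of_le' (ncard_le_ncard hB₀.subset_ground (toFinite _))
  set r := B₀.ncard with hr
  obtain ⟨f, hf, hfE, hmono⟩ := exists_strictMono_enumeration hpos hm
  set j : ℕ → ℕ := fun i => (Finset.univ.filter fun l => pos (f l) < i).card with hj
  have hjle : ∀ i, j i ≤ m + r := fun i => (Finset.card_le_univ _).trans (by simp)
  have hcount : ∀ (B : Finset (Fin (m + r))) i,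
      {x ∈ f '' (B : Set (Fin (m + r))) | pos x < i}.ncard = prefixCount B (j i) := fun B i => by
    rw [prefixCount, ← ncard_coe_finset, ← ncard_image_of_injective _ hf]
    congr 1
    ext x
    simp only [mem_image, Finset.coe_filter, mem_ofPred_eq]
    constructor
    · rintro ⟨⟨k, hk, rfl⟩, h⟩
      exact ⟨k, ⟨hk, (lt_iff_lt_card_filter_of_strictMono hmono i k).1 h⟩, rfl⟩
    · rintro ⟨k, ⟨hk, h⟩, rfl⟩
      exact ⟨⟨k, hk, rfl⟩, (lt_iff_lt_card_filter_of_strictMono hmono i k).2 h⟩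
  set F : Finset (Finset (Fin (m + r))) := Finset.univ.filter fun B => M.IsBase (f '' B) with hF
  have hFmem : ∀ B, B ∈ F ↔ ∀ i, a i ≤ (prefixCount B (j i) : ℤ) ∧
      (prefixCount B (j i) : ℤ) ≤ b i := fun B => by
    rw [hF, Finset.mem_filter, hM _ ((image_subset_range _ _).trans hfE.subset)]
    simp only [Finset.mem_univ, true_and, hcount]
  have hne : F.Nonempty := by
    refine ⟨(toFinite (f ⁻¹' B₀)).toFinset, ?_⟩
    rw [hF, Finset.mem_filter, Finite.coe_toFinset, image_preimage_eq_inter_range, hfE,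
      inter_eq_self_of_subset_left hB₀.subset_ground]
    exact ⟨Finset.mem_univ _, hB₀⟩
  have hFcard : ∀ B ∈ F, B.card = r := fun B hB => by
    have := (Finset.mem_filter.1 hB).2.ncard_eq_ncard_of_isBase hB₀
    rwa [ncard_image_of_injective _ hf, ncard_coe_finset] at this
  -- The minimum climbs by at most one: a base that is minimal at `i` bounds the minimum at `i + 1`.
  obtain ⟨BP, hBP⟩ := exists_prefixCount_eq (n := m + r) (fun i => F.inf' hne (prefixCount · i))
    (by simp [prefixCount_zero])
    (fun i i' hi => Finset.inf'_mono_fun fun B _ => prefixCount_mono B hi) (fun i => by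
      obtain ⟨B, hB, h⟩ := F.exists_mem_eq_inf' hne (prefixCount · i)
      rw [h]
      exact (Finset.inf'_le _ hB).trans (prefixCount_succ_le B i))
  obtain ⟨BQ, hBQ⟩ := exists_prefixCount_eq (n := m + r) (fun i => F.sup' hne (prefixCount · i))
    (by simp [prefixCount_zero])
    (fun i i' hi => Finset.sup'_mono_fun fun B _ => prefixCount_mono B hi) (fun i => by
      exact Finset.sup'_le _ _ fun B hB => (prefixCount_succ_le B i).trans
        (Nat.add_le_add_right (Finset.le_sup' (prefixCount · i) hB) 1))
  have hcardP : BP.card = r := by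
    rw [← prefixCount_of_le BP le_rfl, hBP _ le_rfl]
    obtain ⟨B, hB, h⟩ := F.exists_mem_eq_inf' hne (prefixCount · (m + r))
    rw [h, prefixCount_of_le _ le_rfl, hFcard B hB]
  have hcardQ : BQ.card = r := by
    rw [← prefixCount_of_le BQ le_rfl, hBQ _ le_rfl]
    obtain ⟨B, hB, h⟩ := F.exists_mem_eq_sup' hne (prefixCount · (m + r))
    rw [h, prefixCount_of_le _ le_rfl, hFcard B hB]
  set P := LatticePath.ofNorthSteps BP hcardP
  set Q := LatticePath.ofNorthSteps BQ hcardQ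
  have hP : ∀ i ≤ m + r, P.height i = F.inf' hne (prefixCount · i) := fun i hi => by
    rw [P.height_eq_prefixCount, LatticePath.northSteps_ofNorthSteps, hBP i hi]
  have hQ : ∀ i ≤ m + r, Q.height i = F.sup' hne (prefixCount · i) := fun i hi => by
    rw [Q.height_eq_prefixCount, LatticePath.northSteps_ofNorthSteps, hBQ i hi]
  have hPQ : P.NeverAbove Q := fun i hi => by
    rw [hP i hi, hQ i hi]
    obtain ⟨B, hB⟩ := hne
    exact (Finset.inf'_le _ hB).trans (Finset.le_sup' (prefixCount · i) hB)
  refine isLatticePathMatroid_iff_exists_map.2 ⟨m, r, P, Q, f, hf, hPQ, ?_⟩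
  refine Matroid.ext_isBase ?_ fun B hB => ?_
  · rw [Matroid.map_ground, ← hfE]
    exact image_univ.symm
  rw [← hfE, ← image_univ] at hB
  obtain ⟨B, -, rfl⟩ := (subset_image_iff).1 hB
  lift B to Finset (Fin (m + r)) using toFinite B
  rw [Matroid.map_image_isBase_iff (subset_univ _), hPQ.isBase_iff]
  have hBF : M.IsBase (f '' B) ↔ B ∈ F := by simp [hF]
  rw [hBF]
  constructor
  · intro hB i
    rcases le_total i (m + r) with hi | hi
    · rw [hP i hi, hQ i hi]
      exact ⟨Finset.inf'_le _ hB, Finset.le_sup' (prefixCount · i) hB⟩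
    · rw [P.height_of_le hi, Q.height_of_le hi, prefixCount_of_le _ hi, hFcard B hB]
      exact ⟨le_rfl, le_rfl⟩
  · intro hB
    refine (hFmem B).2 fun i => ?_
    obtain ⟨h1, h2⟩ := hB (j i)
    rw [hP _ (hjle i)] at h1
    rw [hQ _ (hjle i)] at h2
    -- Each extreme count is attained by a base, which satisfies the original bounds at `i`; hence
    -- so does anything between the extremes.
    obtain ⟨B₁, hB₁, e₁⟩ := F.exists_mem_eq_inf' hne (prefixCount · (j i))
    obtain ⟨B₂, hB₂, e₂⟩ := F.exists_mem_eq_sup' hne (prefixCount · (j i))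
    have h3 := ((hFmem B₁).1 hB₁ i).1
    have h4 := ((hFmem B₂).1 hB₂ i).2
    rw [e₁] at h1
    rw [e₂] at h2
    omega

end Corridor

/-! ### Minors and direct sums -/

section Closure

variable {α : Type*} {M N : Matroid α}

theorem Matroid.delete_singleton_isBase_iff {e : α} (he : e ∈ M.E) (hcol : ¬ M.IsColoop e)
    {B : Set α} : (M ＼ {e}).IsBase B ↔ M.IsBase B ∧ e ∉ B := by
  have hco : M.Coindep {e} := by
    rw [Matroid.isColoop_iff_forall_mem_isBase] at hcol
    push Not at hcol
    obtain ⟨B, hB, heB⟩ := hcol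
    exact (Matroid.coindep_iff_exists (singleton_subset_iff.2 he)).2
      ⟨B, hB, subset_sdiff_singleton hB.subset_ground heB⟩
  rw [hco.delete_isBase_iff, disjoint_singleton_right]

theorem Matroid.contract_singleton_isBase_iff {e : α} (he : M.IsNonloop e)
    {B : Set α} : (M ／ {e}).IsBase B ↔ M.IsBase (insert e B) ∧ e ∉ B := by
  rw [he.indep.contract_isBase_iff, disjoint_singleton_right, union_singleton]

/-- Adding `e` back raises every count past its position by one, so both bounds drop by one there.
-/
theorem IsCorridorMatroid.contract_singleton [Finite α] (hM : IsCorridorMatroid M) {e : α}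
    (he : M.IsNonloop e) : IsCorridorMatroid (M ／ {e}) := by
  obtain ⟨pos, a, b, hpos, h⟩ := hM
  refine ⟨pos, fun i => a i - if pos e < i then 1 else 0, fun i => b i - if pos e < i then 1 else 0,
    hpos.mono sdiff_subset, fun B hB => ?_⟩
  have heB : e ∉ B := fun h => (hB h).2 rfl
  rw [Matroid.contract_singleton_isBase_iff he, and_iff_left heB,
    h _ (insert_subset he.mem_ground (hB.trans sdiff_subset))]
  refine forall_congr' fun i => ?_
  have hcount : {x ∈ insert e B | pos x < i}.ncard =
      {x ∈ B | pos x < i}.ncard + if pos e < i then 1 else 0 := by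
    split_ifs with hi
    · rw [← ncard_insert_of_notMem (fun h => heB h.1) (toFinite _)]
      congr 1
      ext x
      grind
    · congr 1
      ext x
      grind
  rw [hcount]
  by_cases hi : pos e < i <;> simp only [hi, if_true, if_false] <;> push_cast <;> omega

theorem IsCorridorMatroid.delete_singleton (hM : IsCorridorMatroid M) {e : α}
    (he : e ∈ M.E) (hcol : ¬ M.IsColoop e) : IsCorridorMatroid (M ＼ {e}) := by
  obtain ⟨pos, a, b, hpos, h⟩ := hM
  refine ⟨pos, a, b, hpos.mono sdiff_subset, fun B hB => ?_⟩
  have heB : e ∉ B := fun h => (hB h).2 rfl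
  rw [Matroid.delete_singleton_isBase_iff he hcol, and_iff_left heB, h _ (hB.trans sdiff_subset)]

variable [Finite α]

/-- For a loop or a coloop, deletion and contraction coincide, so whichever has the simple
description of bases serves for both. -/
theorem IsLatticePathMatroid.contract_and_delete_singleton (hM : IsLatticePathMatroid M) (e : α) :
    IsLatticePathMatroid (M ／ {e}) ∧ IsLatticePathMatroid (M ＼ {e}) := by
  by_cases he : e ∈ M.E
  · by_cases hl : M.IsLoop e
    · have hcol : ¬ M.IsColoop e := fun h => h.isNonloop.not_isLoop hl
      rw [Matroid.contract_eq_delete_of_subset_loops (singleton_subset_iff.2 hl), and_self]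
      exact (hM.isCorridorMatroid.delete_singleton he hcol).isLatticePathMatroid
    · have h1 := (hM.isCorridorMatroid.contract_singleton (e := e)
        ((Matroid.not_isLoop_iff he).1 hl)).isLatticePathMatroid
      by_cases hcol : M.IsColoop e
      · rw [← Matroid.contract_eq_delete_of_subset_coloops (singleton_subset_iff.2 hcol)]
        exact ⟨h1, h1⟩
      · exact ⟨h1, (hM.isCorridorMatroid.delete_singleton he hcol).isLatticePathMatroid⟩
  · rw [Matroid.contractElem_eq_self he, Matroid.deleteElem_eq_self he]
    exact ⟨hM, hM⟩

theorem IsLatticePathMatroid.contract (hM : IsLatticePathMatroid M) (C : Set α) :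
    IsLatticePathMatroid (M ／ C) := by
  induction C, toFinite C using Set.Finite.induction_on with
  | empty => rwa [Matroid.contract_empty]
  | @insert e C _ _ ih =>
    rw [← union_singleton, ← Matroid.contract_contract]
    exact (ih.contract_and_delete_singleton e).1

theorem IsLatticePathMatroid.delete (hM : IsLatticePathMatroid M) (D : Set α) :
    IsLatticePathMatroid (M ＼ D) := by
  induction D, toFinite D using Set.Finite.induction_on with
  | empty => rwa [Matroid.delete_empty]
  | @insert e C _ _ ih =>
    rw [← union_singleton, ← Matroid.delete_delete]
    exact (ih.contract_and_delete_singleton e).2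

theorem IsLatticePathMatroid.restrict (hM : IsLatticePathMatroid M) {S : Set α} (hS : S ⊆ M.E) :
    IsLatticePathMatroid (M ↾ S) := by
  rw [← sdiff_sdiff_cancel_left hS, Matroid.restrict_compl]
  exact hM.delete _

theorem IsLatticePathMatroid.disjointSum (hM : IsLatticePathMatroid M)
    (hN : IsLatticePathMatroid N) (hd : Disjoint M.E N.E) :
    IsLatticePathMatroid (M.disjointSum N hd) := by
  classical
  refine IsCorridorMatroid.isLatticePathMatroid ?_
  obtain ⟨p, a, b, hp, hM⟩ := hM.isCorridorMatroid
  obtain ⟨q, c, d, hq, hN⟩ := hN.isCorridorMatroid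
  obtain ⟨B₁, hB₁⟩ := M.exists_isBase
  obtain ⟨B₂, hB₂⟩ := N.exists_isBase
  obtain ⟨K, hK⟩ : ∃ K, ∀ x, p x < K := by
    obtain ⟨K, hK⟩ := (finite_range p).bddAbove
    exact ⟨K + 1, fun x => Nat.lt_succ_of_le (hK (mem_range_self x))⟩
  have hb₁ := (hM B₁ hB₁.subset_ground).1 hB₁
  have hb₂ := (hN B₂ hB₂.subset_ground).1 hB₂
  -- All of `N` is placed after `M`. The equal bounds at `K` pin the number of elements in `M.E` to
  -- the rank of `M`, which decouples the two families of constraints.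
  refine ⟨fun x => if x ∈ M.E then p x else K + q x,
    fun i => if i < K then a i else if i = K then B₁.ncard else B₁.ncard + c (i - K),
    fun i => if i < K then b i else if i = K then B₁.ncard else B₁.ncard + d (i - K),
    ?_, fun B hB => ?_⟩
  · rw [Matroid.disjointSum_ground_eq]
    rintro x hx y hy hxy
    have hxN : x ∈ N.E → x ∉ M.E := fun h h' => hd.notMem_of_mem_left h' h
    have hyN : y ∈ N.E → y ∉ M.E := fun h h' => hd.notMem_of_mem_left h' h
    have h1 := hK x
    have h2 := hK y
    by_cases hxM : x ∈ M.E <;> by_cases hyM : y ∈ M.E <;>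
      simp only [hxM, hyM, if_true, if_false] at hxy
    · exact hp hxM hyM hxy
    · omega
    · omega
    · exact hq (hx.resolve_left hxM) (hy.resolve_left hyM) (by omega)
  · rw [Matroid.disjointSum_ground_eq] at hB
    rw [Matroid.disjointSum_isBase_iff, and_iff_left hB, hM _ inter_subset_right,
      hN _ inter_subset_right]
    have hlow : ∀ i ≤ K, {x ∈ B | (if x ∈ M.E then p x else K + q x) < i}.ncard =
        {x ∈ B ∩ M.E | p x < i}.ncard := fun i hi => by
      congr 1
      ext x
      grind
    have hhigh : ∀ i, {x ∈ B | (if x ∈ M.E then p x else K + q x) < K + i}.ncard =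
        (B ∩ M.E).ncard + {x ∈ B ∩ N.E | q x < i}.ncard := fun i => by
      rw [← ncard_union_eq _ (toFinite _) (toFinite _)]
      · congr 1
        ext x
        have := hK x
        have : x ∈ B → x ∈ M.E ∨ x ∈ N.E := fun h => hB h
        have : x ∈ N.E → x ∉ M.E := fun h h' => hd.notMem_of_mem_left h' h
        simp only [mem_union, mem_inter_iff, mem_ofPred_eq]
        grind
      · exact hd.mono inter_subset_right (fun x hx => hx.1.2)
    have hall : ∀ (C : Set α) i, K ≤ i → {x ∈ C | p x < i}.ncard = C.ncard := fun C i hi => by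
      congr 1
      ext x
      have := hK x
      grind
    have hN0 : ∀ C : Set α, {x ∈ C | q x < 0}.ncard = 0 := by simp
    constructor
    · rintro ⟨h1, h2⟩ i
      have hcard : (B ∩ M.E).ncard = B₁.ncard :=
        ((hM _ inter_subset_right).2 h1).ncard_eq_ncard_of_isBase hB₁
      rcases lt_or_ge i K with hi | hi
      · simp only [hlow i hi.le, hi, if_true]
        exact h1 i
      · obtain ⟨i, rfl⟩ := Nat.exists_eq_add_of_le hi
        rw [hhigh, hcard]
        rcases Nat.eq_zero_or_pos i with rfl | hi0
        · simp
        · have := h2 i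
          simp only [Nat.not_lt.2 hi, if_false, Nat.add_sub_cancel_left,
            show ¬ K + i = K by omega]
          push_cast
          omega
    · intro h
      have hcard : (B ∩ M.E).ncard = B₁.ncard := by
        have := h K
        rw [hlow K le_rfl, hall _ _ le_rfl] at this
        simp only [lt_irrefl, if_false, if_true] at this
        omega
      constructor
      · intro i
        rcases lt_or_ge i K with hi | hi
        · have := h i
          simpa only [hlow i hi.le, hi, if_true] using this
        -- Past `K` every element of `M.E` is counted, so the constraint depends only on the size
        -- and is inherited from `B₁`. Likewise, the constraint of `N` at `0` is inherited from
        -- `B₂`.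
        · have := hb₁ i
          rw [hall _ _ hi] at this ⊢
          rwa [hcard]
      · intro i
        rcases Nat.eq_zero_or_pos i with rfl | hi0
        · have := hb₂ 0
          rw [hN0] at this ⊢
          exact this
        · have := h (K + i)
          rw [hhigh, hcard] at this
          simp only [show ¬ K + i < K by omega, if_false, Nat.add_sub_cancel_left,
            show ¬ K + i = K by omega] at this
          push_cast at this
          omega

end Closure

/-! ### Bases of maximal weight -/

section MaxWeight

variable {α : Type*} {M : Matroid α}

theorem Matroid.IsBasis.contract_isBase_iff {I S J : Set α} (hI : M.IsBasis I S) :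
    (M ／ S).IsBase J ↔ M.IsBase (J ∪ I) ∧ Disjoint S J := by
  constructor
  · intro hJ
    obtain ⟨hJI, hSJ⟩ := hI.contract_indep_iff.1 hJ.indep
    refine ⟨?_, hSJ⟩
    obtain ⟨B, hB, hJB⟩ := hJI.exists_isBase_superset
    obtain ⟨hJB, hIB⟩ := union_subset_iff.1 hJB
    have h1 : (M ／ S).Indep (B \ S) := hI.contract_indep_iff.2
      ⟨hB.indep.subset (union_subset sdiff_subset hIB), disjoint_sdiff_right⟩
    have h2 : J = B \ S := hJ.eq_of_subset_indep h1 (subset_sdiff.2 ⟨hJB, hSJ.symm⟩)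
    have h3 : I = B ∩ S := hI.eq_of_subset_indep (hB.indep.subset inter_subset_left)
      (subset_inter hIB hI.subset) inter_subset_right
    rwa [h2, h3, sdiff_union_inter]
  · rintro ⟨hJI, hSJ⟩
    obtain ⟨K, hK, hJK⟩ := (hI.contract_indep_iff.2 ⟨hJI.indep, hSJ⟩).exists_isBase_superset
    obtain ⟨hKI, hSK⟩ := hI.contract_indep_iff.1 hK.indep
    have h1 := hJI.eq_of_subset_indep hKI (union_subset_union_left _ hJK)
    have h2 : K ⊆ J := fun x hx => by
      have : x ∈ J ∪ I := h1 ▸ Or.inl hx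
      exact this.resolve_right fun hxI => hSK.notMem_of_mem_left (hI.subset hxI) hx
    rwa [subset_antisymm hJK h2]

/-- `N` is left arbitrary because it will be both `M ／ S` and the matroid of maximal weight bases of
`M ／ S`. -/
theorem Matroid.disjointSum_restrict_isBase_iff {S B : Set α} {N : Matroid α} (hS : S ⊆ M.E)
    (hN : N.E = M.E \ S) (hd : Disjoint (M ↾ S).E N.E) :
    ((M ↾ S).disjointSum N hd).IsBase B ↔
      M.IsBasis (B ∩ S) S ∧ N.IsBase (B \ S) ∧ B ⊆ M.E := by
  rw [Matroid.disjointSum_isBase_iff, Matroid.restrict_ground_eq, Matroid.isBase_restrict_iff hS,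
    hN, union_sdiff_cancel hS]
  refine and_congr_right fun _ => and_congr_left fun hB => ?_
  rw [← inter_sdiff_assoc, inter_eq_self_of_subset_left hB]

variable [Fintype α]

/-- The total weight of a set. -/
noncomputable def setWeight (w : α → ℝ) (B : Set α) : ℝ := ∑ x, B.indicator w x

theorem setWeight_union (w : α → ℝ) {A B : Set α} (h : Disjoint A B) :
    setWeight w (A ∪ B) = setWeight w A + setWeight w B := by
  rw [setWeight, indicator_union_of_disjoint h, Finset.sum_add_distrib]
  rfl

theorem setWeight_inter_add_sdiff (w : α → ℝ) (A B : Set α) :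
    setWeight w (A ∩ B) + setWeight w (A \ B) = setWeight w A := by
  rw [← setWeight_union w disjoint_sdiff_inter.symm, inter_union_sdiff]

theorem setWeight_const (c : ℝ) (A : Set α) : setWeight (fun _ => c) A = c * A.ncard := by
  classical
  simp [setWeight, indicator_apply, Finset.sum_ite, ncard_eq_toFinset_card', mul_comm,
    toFinset_card, Fintype.card_subtype]

theorem setWeight_lt_const {w : α → ℝ} {c : ℝ} {A : Set α} (h : ∀ x ∈ A, w x < c)
    (hA : A.Nonempty) : setWeight w A < c * A.ncard := by
  rw [← setWeight_const]
  obtain ⟨y, hy⟩ := hA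
  refine Finset.sum_lt_sum (fun x _ => indicator_le_indicator' fun hx => (h x hx).le)
    ⟨y, Finset.mem_univ _, ?_⟩
  rw [indicator_of_mem hy, indicator_of_mem hy]
  exact h y hy

theorem setWeight_eq_const {w : α → ℝ} {c : ℝ} {A : Set α} (h : ∀ x ∈ A, w x = c) :
    setWeight w A = c * A.ncard := by
  rw [← setWeight_const, setWeight, setWeight]
  exact Finset.sum_congr rfl fun x _ => congrFun (indicator_congr h) x

/-- A base whose trace on the set of heaviest elements is not spanning there can be improved. -/
theorem Matroid.IsBase.exists_isBasis_inter_setWeight_le {w : α → ℝ} {c : ℝ} {S B : Set α}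
    (hB : M.IsBase B) (hS : S ⊆ M.E) (hSc : ∀ x ∈ S, w x = c) (hlt : ∀ x ∈ M.E \ S, w x < c) :
    ∃ B', M.IsBase B' ∧ M.IsBasis (B' ∩ S) S ∧ setWeight w B ≤ setWeight w B' ∧
      (setWeight w B = setWeight w B' → M.IsBasis (B ∩ S) S) := by
  by_cases hBS : M.IsBasis (B ∩ S) S
  · exact ⟨B, hB, hBS, le_rfl, fun _ => hBS⟩
  obtain ⟨I, hI, hBI⟩ := (hB.indep.subset inter_subset_left).subset_isBasis_of_subset
    (inter_subset_right (s := B) (t := S)) hS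
  -- Completing `I` by elements of `B` makes every gained element lie in `S`, of weight `c`, and
  -- every lost one lie outside `S`, of smaller weight. Equally many are gained and lost.
  obtain ⟨B', hB', hIB', hB'I⟩ := hI.indep.exists_isBase_subset_union_isBase hB
  have hI' : I = B' ∩ S := hI.eq_of_subset_indep (hB'.indep.subset inter_subset_left)
      (subset_inter hIB' hI.subset) inter_subset_right
  have h1 : setWeight w (B' \ B) = c * (B' \ B).ncard := setWeight_eq_const fun x hx =>
    hSc x (hI.subset ((hB'I hx.1).resolve_right hx.2))
  have hne : (B \ B').Nonempty := by
    by_contra! hcon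
    rw [sdiff_eq_empty] at hcon
    have := hB.eq_of_subset_isBase hB' hcon
    subst this
    exact hBS (hI' ▸ hI)
  have h2 : setWeight w (B \ B') < c * (B \ B').ncard := by
    refine setWeight_lt_const (fun x hx => hlt x ⟨hB.subset_ground hx.1, fun hxS => ?_⟩) hne
    exact hx.2 (hIB' (hBI ⟨hx.1, hxS⟩))
  have h3 := setWeight_inter_add_sdiff w B B'
  have h4 := setWeight_inter_add_sdiff w B' B
  rw [hB.ncard_sdiff_comm hB'] at h2
  rw [inter_comm] at h4
  have h5 : setWeight w B < setWeight w B' := by linarith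
  exact ⟨B', hB', hI' ▸ hI, h5.le, fun h => absurd h h5.ne⟩

/-- The bases of maximal weight of a lattice path matroid form a lattice path matroid. -/
theorem IsLatticePathMatroid.exists_isBase_iff_setWeight_max (hM : IsLatticePathMatroid M)
    (w : α → ℝ) :
    ∃ N : Matroid α, N.E = M.E ∧ IsLatticePathMatroid N ∧ ∀ B, N.IsBase B ↔
      M.IsBase B ∧ ∀ B', M.IsBase B' → setWeight w B' ≤ setWeight w B := by
  induction hn : M.E.ncard using Nat.strong_induction_on generalizing M with
  | _ n ih =>
  rcases M.E.eq_empty_or_nonempty with hE | hE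
  · refine ⟨M, rfl, hM, fun B => ⟨fun hB => ⟨hB, fun B' hB' => ?_⟩, And.left⟩⟩
    rw [subset_empty_iff.1 (hB.subset_ground.trans hE.subset),
      subset_empty_iff.1 (hB'.subset_ground.trans hE.subset)]
  obtain ⟨e, he, hmax⟩ := exists_max_image M.E w (toFinite _) hE
  set S := {x ∈ M.E | w x = w e} with hSdef
  have hS : S ⊆ M.E := sep_subset _ _
  have hSc : ∀ x ∈ S, w x = w e := fun x hx => hx.2
  have hlt : ∀ x ∈ M.E \ S, w x < w e := fun x hx =>
    (hmax x hx.1).lt_of_ne fun h => hx.2 ⟨hx.1, h⟩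
  obtain ⟨N, hNE, hN, hNB⟩ := ih (M ／ S).E.ncard (by
    rw [← hn]
    refine ncard_lt_ncard ⟨sdiff_subset, fun h => ?_⟩ (toFinite _)
    exact (h he).2 ⟨he, rfl⟩) (hM.contract S) rfl
  rw [Matroid.contract_ground] at hNE
  have hd : Disjoint (M ↾ S).E N.E := by
    rw [hNE]
    exact disjoint_sdiff_right
  refine ⟨(M ↾ S).disjointSum N hd, ?_, (hM.restrict hS).disjointSum hN hd, fun B => ?_⟩
  · rw [Matroid.disjointSum_ground_eq, hNE]
    exact union_sdiff_cancel hS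
  rw [Matroid.disjointSum_restrict_isBase_iff hS hNE, hNB]
  constructor
  · rintro ⟨hBS, ⟨hB, hBmax⟩, hBE⟩
    have hB' := (hBS.contract_isBase_iff.1 hB).1
    rw [sdiff_union_inter] at hB'
    refine ⟨hB', fun B' h => ?_⟩
    -- A competitor may be assumed to span `S`; then its trace on `S` weighs as much as that of `B`,
    -- and the comparison takes place in `M ／ S`.
    obtain ⟨B'', h1, h2, h3, -⟩ := h.exists_isBasis_inter_setWeight_le hS hSc hlt
    refine h3.trans ?_
    have h4 := hBmax (B'' \ S) (h2.contract_isBase_iff.2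
      ⟨by rwa [sdiff_union_inter], disjoint_sdiff_right⟩)
    rw [← setWeight_inter_add_sdiff w B'' S, ← setWeight_inter_add_sdiff w B S,
      setWeight_eq_const (A := B'' ∩ S) fun x hx => hSc x hx.2,
      setWeight_eq_const (A := B ∩ S) fun x hx => hSc x hx.2, ncard_def, h2.encard_eq_encard hBS,
      ← ncard_def]
    linarith
  · rintro ⟨hB, hBmax⟩
    obtain ⟨B', h1, h2, h3, h4⟩ := hB.exists_isBasis_inter_setWeight_le hS hSc hlt
    have hBS := h4 (h3.antisymm (hBmax B' h1))
    refine ⟨hBS, ⟨hBS.contract_isBase_iff.2 ⟨by rwa [sdiff_union_inter], disjoint_sdiff_right⟩,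
      fun J hJ => ?_⟩, hB.subset_ground⟩
    obtain ⟨h5, h6⟩ := hBS.contract_isBase_iff.1 hJ
    have h7 := hBmax _ h5
    rw [setWeight_union _ (h6.symm.mono_right inter_subset_right),
      ← setWeight_inter_add_sdiff w B S] at h7
    linarith

end MaxWeight

/-! ### Faces of convex hulls and of matroid polytopes -/

section Faces

variable {E : Type*} [AddCommGroup E] [Module ℝ E] [TopologicalSpace E]

theorem le_of_mem_convexHull {V : Set E} {l : StrongDual ℝ E} {c : ℝ} (h : ∀ v ∈ V, l v ≤ c)
    {x : E} (hx : x ∈ convexHull ℝ V) : l x ≤ c :=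
  convexHull_min h (convex_halfSpace_le l.toLinearMap.isLinear c) hx

/-- A convex combination with positive coefficients attains the bound `c` only if both of its points
do. -/
theorem sep_convexHull_eq_convexHull_sep {V : Set E} {l : StrongDual ℝ E} {c : ℝ}
    (h : ∀ v ∈ V, l v ≤ c) :
    {x ∈ convexHull ℝ V | l x = c} = convexHull ℝ {v ∈ V | l v = c} := by
  refine subset_antisymm (fun x hx => ?_) fun x hx => ⟨convexHull_mono (sep_subset _ _) hx, ?_⟩
  · have hsub : convexHull ℝ V ⊆
        {x | l x ≤ c ∧ (l x = c → x ∈ convexHull ℝ {v ∈ V | l v = c})} := by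
      refine convexHull_min (fun v hv => ⟨h v hv, fun hvc => subset_convexHull ℝ _ ⟨hv, hvc⟩⟩) ?_
      rw [convex_iff_forall_pos]
      rintro x ⟨hx, hx'⟩ y ⟨hy, hy'⟩ a b ha hb hab
      simp only [mem_ofPred_eq, map_add, map_smul, smul_eq_mul]
      have h1 : a * l x ≤ a * c := by gcongr
      have h2 : b * l y ≤ b * c := by gcongr
      have h3 : a * c + b * c = c := by rw [← add_mul, hab, one_mul]
      refine ⟨by linarith, fun heq => ?_⟩
      have h4 : l x = c := mul_left_cancel₀ ha.ne' (by linarith)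
      have h5 : l y = c := mul_left_cancel₀ hb.ne' (by linarith)
      exact convex_convexHull ℝ _ (hx' h4) (hy' h5) ha.le hb.le hab
    exact (hsub hx.1).2 hx.2
  · exact convexHull_min (fun v hv => hv.2) (convex_hyperplane l.toLinearMap.isLinear c) hx

theorem isExposed_sep_eq {A : Set E} {l : StrongDual ℝ E} {c : ℝ} (h : ∀ x ∈ A, l x ≤ c) :
    IsExposed ℝ A {x ∈ A | l x = c} := by
  rintro ⟨x, hx, hxc⟩
  refine ⟨l, ?_⟩
  ext y
  refine and_congr_right fun hy => ⟨fun hyc z hz => (h z hz).trans_eq hyc.symm, fun hmax => ?_⟩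
  exact (h y hy).antisymm (hxc ▸ hmax x hx)

end Faces

section MatroidPolytope

variable {α : Type*} {M N : Matroid α}

theorem matroidPolytope_sep_eq {l : StrongDual ℝ (α → ℝ)} {c : ℝ}
    (h : ∀ B, M.IsBase B → l (B.indicator 1) ≤ c) :
    {x ∈ matroidPolytope M | l x = c} = convexHull ℝ ((fun B : Set α => B.indicator (1 : α → ℝ)) ''
      {B | M.IsBase B ∧ l (B.indicator 1) = c}) := by
  rw [matroidPolytope, sep_convexHull_eq_convexHull_sep (by rintro _ ⟨B, hB, rfl⟩; exact h B hB)]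
  congr 1
  ext v
  constructor
  · rintro ⟨⟨B, hB, rfl⟩, hv⟩
    exact ⟨B, ⟨hB, hv⟩, rfl⟩
  · rintro ⟨B, ⟨hB, hv⟩, rfl⟩
    exact ⟨⟨B, hB, rfl⟩, hv⟩

theorem isExposed_matroidPolytope_sep {l : StrongDual ℝ (α → ℝ)} {c : ℝ}
    (h : ∀ B, M.IsBase B → l (B.indicator 1) ≤ c) :
    IsExposed ℝ (matroidPolytope M) {x ∈ matroidPolytope M | l x = c} :=
  isExposed_sep_eq fun _ hx => le_of_mem_convexHull (by rintro _ ⟨B, hB, rfl⟩; exact h B hB) hx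

theorem matroidPolytope_sep_nonempty_iff {l : StrongDual ℝ (α → ℝ)} {c : ℝ}
    (h : ∀ B, M.IsBase B → l (B.indicator 1) ≤ c) :
    {x ∈ matroidPolytope M | l x = c}.Nonempty ↔ ∃ B, M.IsBase B ∧ l (B.indicator 1) = c := by
  rw [matroidPolytope_sep_eq h, convexHull_nonempty_iff, image_nonempty]
  rfl

theorem matroidPolytope_sep_eq_matroidPolytope {l : StrongDual ℝ (α → ℝ)} {c : ℝ}
    (h : ∀ B, M.IsBase B → l (B.indicator 1) ≤ c)
    (hN : ∀ B, N.IsBase B ↔ M.IsBase B ∧ l (B.indicator 1) = c) :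
    {x ∈ matroidPolytope M | l x = c} = matroidPolytope N := by
  rw [matroidPolytope_sep_eq h, matroidPolytope]
  simp only [hN]

/-- Convex hulls commute with Minkowski sums, and the indicator of a disjoint union is the sum of
the indicators. -/
theorem matroidPolytope_disjointSum (hd : Disjoint M.E N.E) :
    matroidPolytope (M.disjointSum N hd) = matroidPolytope M + matroidPolytope N := by
  unfold matroidPolytope
  rw [← convexHull_add]
  congr 1
  ext v
  rw [mem_add]
  constructor
  · rintro ⟨B, hB, rfl⟩
    obtain ⟨h1, h2, h3⟩ := Matroid.disjointSum_isBase_iff.1 hB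
    refine ⟨_, ⟨_, h1, rfl⟩, _, ⟨_, h2, rfl⟩, ?_⟩
    refine (indicator_union_of_disjoint (hd.mono inter_subset_right inter_subset_right)
      (1 : α → ℝ)).symm.trans ?_
    rw [← inter_union_distrib_left, inter_eq_self_of_subset_left h3]
  · rintro ⟨_, ⟨A, hA, rfl⟩, _, ⟨B, hB, rfl⟩, rfl⟩
    have hA' := hA.subset_ground
    have hB' := hB.subset_ground
    refine ⟨A ∪ B, Matroid.disjointSum_isBase_iff.2 ⟨?_, ?_, union_subset_union hA' hB'⟩,
      indicator_union_of_disjoint (hd.mono hA' hB') _⟩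
    · rwa [union_inter_distrib_right, inter_eq_self_of_subset_left hA',
        (hd.symm.mono_left hB').inter_eq, union_empty]
    · rwa [union_inter_distrib_right, inter_eq_self_of_subset_left hB',
        (hd.mono_left hA').inter_eq, empty_union]

theorem StrongDual.apply_indicator_one [Fintype α] [DecidableEq α] (l : StrongDual ℝ (α → ℝ))
    (B : Set α) : l (B.indicator 1) = setWeight (fun k => l (Pi.single k 1)) B := by
  conv_lhs => rw [← Finset.univ_sum_single (B.indicator (1 : α → ℝ)), map_sum]
  refine Finset.sum_congr rfl fun k _ => ?_
  by_cases hk : k ∈ B <;> simp [hk]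

theorem IsLatticePathMatroid.exists_eq_matroidPolytope_of_isExposed [Fintype α]
    (hM : IsLatticePathMatroid M) {F : Set (α → ℝ)} (hF : IsExposed ℝ (matroidPolytope M) F)
    (hne : F.Nonempty) :
    ∃ N : Matroid α, N.E = M.E ∧ IsLatticePathMatroid N ∧ F = matroidPolytope N := by
  classical
  obtain ⟨l, hl⟩ := hF hne
  obtain ⟨x, hx⟩ := hne
  rw [hl] at hx
  have hle : ∀ B, M.IsBase B → l (B.indicator 1) ≤ l x := fun B hB =>
    hx.2 _ (subset_convexHull ℝ _ ⟨B, hB, rfl⟩)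
  have hFx : F = {y ∈ matroidPolytope M | l y = l x} := by
    rw [hl]
    ext y
    exact and_congr_right fun hy => ⟨fun h => (hx.2 y hy).antisymm (h x hx.1),
      fun h z hz => (hx.2 z hz).trans_eq h.symm⟩
  -- The maximum over the polytope is attained at a base, so it equals the maximal weight.
  obtain ⟨B₀, hB₀, hB₀x⟩ := (matroidPolytope_sep_nonempty_iff hle).1 ⟨x, hx.1, rfl⟩
  obtain ⟨N, hNE, hN, hNB⟩ := hM.exists_isBase_iff_setWeight_max fun k => l (Pi.single k 1)
  refine ⟨N, hNE, hN, ?_⟩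
  rw [hFx]
  refine matroidPolytope_sep_eq_matroidPolytope hle fun B => ?_
  rw [hNB]
  simp only [← StrongDual.apply_indicator_one]
  refine and_congr_right fun hB => ⟨fun h => (hle B hB).antisymm ?_, fun h B' hB' => ?_⟩
  · rw [← hB₀x]
    exact h B₀ hB₀
  · rw [h]
    exact hle B' hB'

theorem indicator_one_apply_le_one (B : Set α) (i : α) : B.indicator (1 : α → ℝ) i ≤ 1 :=
  indicator_le_self' (f := (1 : α → ℝ)) (fun _ _ => zero_le_one) i

theorem indicator_one_apply_eq_one_iff {B : Set α} {i : α} :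
    B.indicator (1 : α → ℝ) i = 1 ↔ i ∈ B := by
  by_cases h : i ∈ B <;> simp [h]

theorem indicator_one_apply_eq_zero_iff {B : Set α} {i : α} :
    B.indicator (1 : α → ℝ) i = 0 ↔ i ∉ B := by
  by_cases h : i ∈ B <;> simp [h]

theorem matroidPolytope_sep_apply_eq_zero {i : α} (hi : i ∈ M.E) :
    IsExposed ℝ (matroidPolytope M) {x ∈ matroidPolytope M | x i = 0} ∧
      ({x ∈ matroidPolytope M | x i = 0}.Nonempty ↔ ¬ M.IsColoop i) ∧
      (¬ M.IsColoop i → {x ∈ matroidPolytope M | x i = 0} = matroidPolytope (M ＼ {i})) := by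
  -- The sign turns the minimum `0` of the coordinate into a maximum.
  set l : StrongDual ℝ (α → ℝ) := -ContinuousLinearMap.proj i with hl
  have hle : ∀ B, M.IsBase B → l (B.indicator 1) ≤ 0 := fun B _ => by
    simpa [hl] using indicator_nonneg (s := B) (f := (1 : α → ℝ)) (fun _ _ => zero_le_one) i
  have hF : {x ∈ matroidPolytope M | x i = 0} = {x ∈ matroidPolytope M | l x = 0} := by
    simp [hl]
  have hB : ∀ B : Set α, l (B.indicator 1) = 0 ↔ i ∉ B := fun B => by
    rw [← indicator_one_apply_eq_zero_iff]
    simp [hl]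
  rw [hF]
  refine ⟨isExposed_matroidPolytope_sep hle, ?_, fun hcol => ?_⟩
  · rw [matroidPolytope_sep_nonempty_iff hle, Matroid.isColoop_iff_forall_mem_isBase]
    simp only [hB]
    push Not
    rfl
  · refine matroidPolytope_sep_eq_matroidPolytope hle fun B => ?_
    rw [hB, Matroid.delete_singleton_isBase_iff hi hcol]

theorem matroidPolytope_sep_apply_eq_one [DecidableEq α] {i : α} (hi : i ∈ M.E) :
    IsExposed ℝ (matroidPolytope M) {x ∈ matroidPolytope M | x i = 1} ∧
      ({x ∈ matroidPolytope M | x i = 1}.Nonempty ↔ ¬ M.IsLoop i) ∧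
      (¬ M.IsLoop i → {x ∈ matroidPolytope M | x i = 1} =
        (fun y => y + Pi.single i 1) '' matroidPolytope (M ／ {i})) := by
  set l : StrongDual ℝ (α → ℝ) := ContinuousLinearMap.proj i with hl
  have hle : ∀ B, M.IsBase B → l (B.indicator 1) ≤ 1 := fun B _ => indicator_one_apply_le_one B i
  have hB : ∀ B : Set α, l (B.indicator 1) = 1 ↔ i ∈ B := fun B =>
    indicator_one_apply_eq_one_iff
  change IsExposed ℝ (matroidPolytope M) {x ∈ matroidPolytope M | l x = 1} ∧
    ({x ∈ matroidPolytope M | l x = 1}.Nonempty ↔ _) ∧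
    (_ → {x ∈ matroidPolytope M | l x = 1} = _)
  refine ⟨isExposed_matroidPolytope_sep hle, ?_, fun hloop => ?_⟩
  · rw [matroidPolytope_sep_nonempty_iff hle, Matroid.isLoop_iff_forall_notMem_isBase hi]
    simp only [hB]
    push Not
    rfl
  · have hnl : M.IsNonloop i := (Matroid.not_isLoop_iff hi).1 hloop
    have hind : ∀ C : Set α, i ∉ C →
        (insert i C).indicator (1 : α → ℝ) = C.indicator 1 + Pi.single i 1 := fun C hC => by
      rw [← union_singleton, indicator_union_of_disjoint (disjoint_singleton_right.2 hC)]
      ext k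
      rcases eq_or_ne k i with rfl | hk
      · simp
      · simp [hk]
    have himage : (fun y : α → ℝ => y + Pi.single i 1) '' matroidPolytope (M ／ {i}) =
        convexHull ℝ ((fun y => y + Pi.single i 1) ''
          ((fun B : Set α => B.indicator (1 : α → ℝ)) '' {B | (M ／ {i}).IsBase B})) := by
      have := convexHull_vadd (𝕜 := ℝ) (Pi.single i (1 : ℝ))
        ((fun B : Set α => B.indicator (1 : α → ℝ)) '' {B | (M ／ {i}).IsBase B})
      simpa only [matroidPolytope, ← image_vadd, vadd_eq_add, add_comm] using this.symm
    rw [matroidPolytope_sep_eq hle, himage]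
    congr 1
    simp only [hB, Matroid.contract_singleton_isBase_iff hnl]
    ext v
    constructor
    · rintro ⟨B, ⟨hB, hiB⟩, rfl⟩
      refine ⟨_, ⟨B \ {i}, ⟨?_, fun h => h.2 rfl⟩, rfl⟩, ?_⟩
      · rwa [insert_sdiff_self_of_mem hiB]
      · dsimp only
        rw [← hind _ fun h => h.2 rfl, insert_sdiff_self_of_mem hiB]
    · rintro ⟨_, ⟨C, ⟨hC, hiC⟩, rfl⟩, rfl⟩
      exact ⟨insert i C, ⟨hC, mem_insert _ _⟩, hind C hiC⟩

end MatroidPolytope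

/-! ### Splitting along prefixes -/

section DirectSum

variable {α : Type*} [Finite α] {M : Matroid α}

/-- The hypothesis on `B₀` says that its trace on `S` has the rank of `S` as its size. -/
theorem Matroid.IsBase.isBasis_inter_iff_ncard_eq {S B B₀ : Set α} (hS : S ⊆ M.E)
    (hB₀ : M.IsBase B₀) (hmax : ∀ B, M.IsBase B → (B ∩ S).ncard ≤ (B₀ ∩ S).ncard)
    (hB : M.IsBase B) : M.IsBasis (B ∩ S) S ↔ (B ∩ S).ncard = (B₀ ∩ S).ncard := by
  have key : ∀ I ⊆ S, M.Indep I → (M.IsBasis I S ↔ I.ncard = (B₀ ∩ S).ncard) := by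
    have hub : ∀ I, M.IsBasis I S → I.ncard ≤ (B₀ ∩ S).ncard := fun I hI => by
      obtain ⟨B₁, hB₁, hIB₁⟩ := hI.indep.exists_isBase_superset
      exact (ncard_le_ncard (subset_inter hIB₁ hI.subset) (toFinite _)).trans (hmax B₁ hB₁)
    intro I hIS hI
    constructor
    · intro hIb
      obtain ⟨J, hJ, hsub⟩ := (hB₀.indep.subset inter_subset_left).subset_isBasis_of_subset
        (inter_subset_right (s := B₀) (t := S)) hS
      have h1 := ncard_le_ncard hsub (toFinite _)
      have h2 := hub J hJ
      have h3 : I.ncard = J.ncard := by rw [ncard_def, hIb.encard_eq_encard hJ, ← ncard_def]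
      omega
    · intro hcard
      obtain ⟨J, hJ, hsub⟩ := hI.subset_isBasis_of_subset hIS hS
      have := hub J hJ
      rwa [eq_of_subset_of_ncard_le hsub (by omega) (toFinite _)]
  exact key _ inter_subset_right (hB.indep.subset inter_subset_left)

theorem Matroid.restrict_disjointSum_contract_isBase_iff {S B B₀ : Set α} (hS : S ⊆ M.E)
    (hB₀ : M.IsBase B₀) (hmax : ∀ B, M.IsBase B → (B ∩ S).ncard ≤ (B₀ ∩ S).ncard)
    (hd : Disjoint (M ↾ S).E (M ／ S).E) :
    ((M ↾ S).disjointSum (M ／ S) hd).IsBase B ↔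
      M.IsBase B ∧ (B ∩ S).ncard = (B₀ ∩ S).ncard := by
  rw [Matroid.disjointSum_restrict_isBase_iff hS rfl]
  constructor
  · rintro ⟨h1, h2, -⟩
    have h3 := (h1.contract_isBase_iff.1 h2).1
    rw [sdiff_union_inter] at h3
    exact ⟨h3, (hB₀.isBasis_inter_iff_ncard_eq hS hmax h3).1 h1⟩
  · rintro ⟨h1, h2⟩
    have h3 := (hB₀.isBasis_inter_iff_ncard_eq hS hmax h1).2 h2
    refine ⟨h3, h3.contract_isBase_iff.2 ⟨?_, disjoint_sdiff_right⟩, h1.subset_ground⟩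
    rwa [sdiff_union_inter]

end DirectSum

section PrefixFaces

variable {m r : ℕ} {P Q : LatticePath m r}

theorem ncard_inter_lt {n : ℕ} (B : Finset (Fin n)) (i : ℕ) :
    ((B : Set (Fin n)) ∩ {k | k.val < i}).ncard = prefixCount B i := by
  rw [prefixCount, ← ncard_coe_finset, Finset.coe_filter]
  rfl

theorem prefixCount_add_ncard_inter_ge {n : ℕ} (B : Finset (Fin n)) (i : ℕ) :
    prefixCount B i + ((B : Set (Fin n)) ∩ {k | i ≤ k.val}).ncard = B.card := by
  rw [← ncard_inter_lt, ← ncard_coe_finset, ← ncard_inter_add_ncard_sdiff_eq_ncard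
    (B : Set (Fin n)) {k | k.val < i} (toFinite _)]
  congr 2
  ext k
  simp

theorem sum_indicator_eq_prefixCount {n : ℕ} (B : Finset (Fin n)) (i : ℕ) :
    ∑ k : Fin n with k.val < i, (B : Set (Fin n)).indicator (1 : Fin n → ℝ) k =
      prefixCount B i := by
  classical
  simp only [indicator_apply, Finset.mem_coe, Pi.one_apply, Finset.sum_ite, Finset.sum_const_zero,
    add_zero, Finset.sum_const, nsmul_eq_mul, mul_one, prefixCount]
  congr 2
  ext k
  simp [and_comm]

/-- The sum of the first `i` coordinates. -/
noncomputable def prefixSum {n : ℕ} (i : ℕ) : StrongDual ℝ (Fin n → ℝ) :=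
  ∑ k : Fin n with k.val < i, ContinuousLinearMap.proj k

theorem prefixSum_apply {n : ℕ} (i : ℕ) (x : Fin n → ℝ) :
    prefixSum i x = ∑ k : Fin n with k.val < i, x k := by
  simp [prefixSum]

theorem LatticePath.NeverAbove.isLatticePathMatroid (hPQ : P.NeverAbove Q) :
    IsLatticePathMatroid (P.matroid Q) :=
  ⟨m, r, P, Q, hPQ, Equiv.refl _, fun I => by simp⟩

theorem LatticePath.NeverAbove.isBase_northSteps_left (hPQ : P.NeverAbove Q) :
    (P.matroid Q).IsBase (P.northSteps : Set (Fin (m + r))) :=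
  isBase_of_height_le fun i => ⟨le_rfl, hPQ.height_le i⟩

theorem LatticePath.NeverAbove.isBase_northSteps_right (hPQ : P.NeverAbove Q) :
    (P.matroid Q).IsBase (Q.northSteps : Set (Fin (m + r))) :=
  isBase_of_height_le fun i => ⟨hPQ.height_le i, le_rfl⟩

theorem LatticePath.NeverAbove.upper_face (hPQ : P.NeverAbove Q) (i : ℕ) :
    IsExposed ℝ (matroidPolytope (P.matroid Q))
        {x ∈ matroidPolytope (P.matroid Q) | prefixSum i x = (Q.height i : ℝ)} ∧
      {x ∈ matroidPolytope (P.matroid Q) | prefixSum i x = (Q.height i : ℝ)}.Nonempty ∧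
      ∃ (N₁ N₂ : Matroid (Fin (m + r))) (hd : Disjoint N₁.E N₂.E),
        N₁.E = {k | k.val < i} ∧ N₂.E = {k | i ≤ k.val} ∧
        IsLatticePathMatroid N₁ ∧ IsLatticePathMatroid N₂ ∧
        {x ∈ matroidPolytope (P.matroid Q) | prefixSum i x = (Q.height i : ℝ)} =
          matroidPolytope (N₁.disjointSum N₂ hd) := by
  have hM := hPQ.isLatticePathMatroid
  set M := P.matroid Q with hMdef
  have hle : ∀ B, M.IsBase B → prefixSum i (B.indicator 1) ≤ (Q.height i : ℝ) := fun B hB => by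
    lift B to Finset (Fin (m + r)) using toFinite B
    rw [prefixSum_apply, sum_indicator_eq_prefixCount, Nat.cast_le]
    exact (hPQ.isBase_iff.1 hB i).2
  set S : Set (Fin (m + r)) := {k | k.val < i} with hS
  have hd : Disjoint (M ↾ S).E (M ／ S).E := disjoint_sdiff_right
  refine ⟨isExposed_matroidPolytope_sep hle, (matroidPolytope_sep_nonempty_iff hle).2
    ⟨Q.northSteps, hPQ.isBase_northSteps_right, ?_⟩, M ↾ S, M ／ S, hd, rfl, ?_,
    hM.restrict (subset_univ _), hM.contract S,
    matroidPolytope_sep_eq_matroidPolytope hle fun B => ?_⟩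
  · rw [prefixSum_apply, sum_indicator_eq_prefixCount, Q.height_eq_prefixCount]
  · ext k
    simp [hS, hMdef, LatticePath.matroid, transversalMatroid_ground]
  · rw [Matroid.restrict_disjointSum_contract_isBase_iff (subset_univ _)
      hPQ.isBase_northSteps_right]
    · lift B to Finset (Fin (m + r)) using toFinite B
      rw [ncard_inter_lt, ncard_inter_lt, prefixSum_apply, sum_indicator_eq_prefixCount,
        Nat.cast_inj, Q.height_eq_prefixCount]
    · intro B hB
      lift B to Finset (Fin (m + r)) using toFinite B
      rw [ncard_inter_lt, ncard_inter_lt]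
      exact (hPQ.isBase_iff.1 hB i).2

/-- All bases have the same size, so few elements in the prefix means many in the suffix. Thus `S`
becomes the suffix, and restriction and contraction trade places compared with the upper face. -/
theorem LatticePath.NeverAbove.lower_face (hPQ : P.NeverAbove Q) (i : ℕ) :
    IsExposed ℝ (matroidPolytope (P.matroid Q))
        {x ∈ matroidPolytope (P.matroid Q) | prefixSum i x = (P.height i : ℝ)} ∧
      {x ∈ matroidPolytope (P.matroid Q) | prefixSum i x = (P.height i : ℝ)}.Nonempty ∧
      ∃ (N₁ N₂ : Matroid (Fin (m + r))) (hd : Disjoint N₁.E N₂.E),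
        N₁.E = {k | k.val < i} ∧ N₂.E = {k | i ≤ k.val} ∧
        IsLatticePathMatroid N₁ ∧ IsLatticePathMatroid N₂ ∧
        {x ∈ matroidPolytope (P.matroid Q) | prefixSum i x = (P.height i : ℝ)} =
          matroidPolytope (N₁.disjointSum N₂ hd) := by
  have hM := hPQ.isLatticePathMatroid
  set M := P.matroid Q with hMdef
  have hneg : {x ∈ matroidPolytope M | prefixSum i x = (P.height i : ℝ)} =
      {x ∈ matroidPolytope M | (-prefixSum i : StrongDual ℝ (Fin (m + r) → ℝ)) x =
        -(P.height i : ℝ)} := by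
    simp only [neg_apply, neg_inj]
  have hle : ∀ B, M.IsBase B → (-prefixSum i : StrongDual ℝ (Fin (m + r) → ℝ)) (B.indicator 1) ≤
      -(P.height i : ℝ) := fun B hB => by
    lift B to Finset (Fin (m + r)) using toFinite B
    rw [neg_apply, neg_le_neg_iff, prefixSum_apply,
      sum_indicator_eq_prefixCount, Nat.cast_le]
    exact (hPQ.isBase_iff.1 hB i).1
  set S : Set (Fin (m + r)) := {k | i ≤ k.val} with hS
  have hd : Disjoint (M ／ S).E (M ↾ S).E := disjoint_sdiff_left
  have hcard : ∀ B : Finset (Fin (m + r)), M.IsBase (B : Set (Fin (m + r))) →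
      prefixCount B i + ((B : Set (Fin (m + r))) ∩ S).ncard =
        P.height i + ((P.northSteps : Set (Fin (m + r))) ∩ S).ncard := fun B hB => by
    rw [P.height_eq_prefixCount, prefixCount_add_ncard_inter_ge, prefixCount_add_ncard_inter_ge,
      ← ncard_coe_finset, ← ncard_coe_finset]
    exact hB.ncard_eq_ncard_of_isBase hPQ.isBase_northSteps_left
  rw [hneg]
  refine ⟨isExposed_matroidPolytope_sep hle, (matroidPolytope_sep_nonempty_iff hle).2
    ⟨P.northSteps, hPQ.isBase_northSteps_left, ?_⟩, M ／ S, M ↾ S, hd, ?_, rfl,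
    hM.contract S, hM.restrict (subset_univ _),
    matroidPolytope_sep_eq_matroidPolytope hle fun B => ?_⟩
  · rw [neg_apply, prefixSum_apply, sum_indicator_eq_prefixCount,
      P.height_eq_prefixCount]
  · ext k
    simp [hS, hMdef, LatticePath.matroid, transversalMatroid_ground]
  · rw [Matroid.disjointSum_comm, Matroid.restrict_disjointSum_contract_isBase_iff (subset_univ _)
      hPQ.isBase_northSteps_left]
    · refine and_congr_right fun hB => ?_
      lift B to Finset (Fin (m + r)) using toFinite B
      rw [neg_apply, neg_inj, prefixSum_apply, sum_indicator_eq_prefixCount,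
        Nat.cast_inj]
      have := hcard B hB
      omega
    · intro B hB
      lift B to Finset (Fin (m + r)) using toFinite B
      have := hcard B hB
      have := (hPQ.isBase_iff.1 hB i).1
      omega

end PrefixFaces

/-! ### The main theorem -/

theorem mainTheorem1 :
    -- Every (nonempty) face of a lattice path matroid polytope is a lattice path matroid polytope.
    (∀ (n : ℕ) (M : Matroid (Fin n)), IsLatticePathMatroid M →
      ∀ F : Set (Fin n → ℝ), IsExposed ℝ (matroidPolytope M) F → F.Nonempty →
        ∃ N : Matroid (Fin n), N.E = M.E ∧ IsLatticePathMatroid N ∧ F = matroidPolytope N) ∧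
    -- The faces `x_1 + ⋯ + x_i = p_i` and `x_1 + ⋯ + x_i = q_i` are direct sums.
    (∀ (m r : ℕ) (P Q : LatticePath m r), P.NeverAbove Q →
      ∀ R : LatticePath m r, R = P ∨ R = Q → ∀ i : ℕ, i ≤ m + r →
        ∀ F : Set (Fin (m + r) → ℝ),
          F = {x ∈ matroidPolytope (P.matroid Q) |
            ∑ k : Fin (m + r) with k.val < i, x k = (R.height i : ℝ)} →
          IsExposed ℝ (matroidPolytope (P.matroid Q)) F ∧ F.Nonempty ∧
          ∃ (N₁ N₂ : Matroid (Fin (m + r))) (hd : Disjoint N₁.E N₂.E),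
            N₁.E = {k | k.val < i} ∧ N₂.E = {k | i ≤ k.val} ∧
            IsLatticePathMatroid N₁ ∧ IsLatticePathMatroid N₂ ∧
            IsLatticePathMatroid (N₁.disjointSum N₂ hd) ∧
            F = matroidPolytope (N₁.disjointSum N₂ hd) ∧
            F = matroidPolytope N₁ + matroidPolytope N₂) ∧
    -- The faces `x_i = 0` and `x_i = 1` are given by deletion and contraction.
    (∀ (n : ℕ) (M : Matroid (Fin n)), IsLatticePathMatroid M → ∀ i ∈ M.E,
      (IsLatticePathMatroid (M ＼ {i}) ∧
        IsExposed ℝ (matroidPolytope M) {x ∈ matroidPolytope M | x i = 0} ∧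
        ({x ∈ matroidPolytope M | x i = 0}.Nonempty ↔ ¬ M.IsColoop i) ∧
        (¬ M.IsColoop i → {x ∈ matroidPolytope M | x i = 0} = matroidPolytope (M ＼ {i}))) ∧
      (IsLatticePathMatroid (M ／ {i}) ∧
        IsExposed ℝ (matroidPolytope M) {x ∈ matroidPolytope M | x i = 1} ∧
        ({x ∈ matroidPolytope M | x i = 1}.Nonempty ↔ ¬ M.IsLoop i) ∧
        (¬ M.IsLoop i → {x ∈ matroidPolytope M | x i = 1} =
          (fun y => y + Pi.single i 1) '' matroidPolytope (M ／ {i})))) := by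
  refine ⟨fun n M hM F hF hne => hM.exists_eq_matroidPolytope_of_isExposed hF hne, ?_,
    fun n M hM i hi => ⟨⟨(hM.contract_and_delete_singleton i).2,
      matroidPolytope_sep_apply_eq_zero hi⟩, (hM.contract_and_delete_singleton i).1,
      matroidPolytope_sep_apply_eq_one hi⟩⟩
  intro m r P Q hPQ R hR i _ F hF
  simp only [← prefixSum_apply] at hF
  subst hF
  have key : ∀ G : Set (Fin (m + r) → ℝ), (∃ (N₁ N₂ : Matroid (Fin (m + r)))
        (hd : Disjoint N₁.E N₂.E), N₁.E = {k | k.val < i} ∧ N₂.E = {k | i ≤ k.val} ∧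
        IsLatticePathMatroid N₁ ∧ IsLatticePathMatroid N₂ ∧
        G = matroidPolytope (N₁.disjointSum N₂ hd)) →
      ∃ (N₁ N₂ : Matroid (Fin (m + r))) (hd : Disjoint N₁.E N₂.E),
        N₁.E = {k | k.val < i} ∧ N₂.E = {k | i ≤ k.val} ∧
        IsLatticePathMatroid N₁ ∧ IsLatticePathMatroid N₂ ∧
        IsLatticePathMatroid (N₁.disjointSum N₂ hd) ∧
        G = matroidPolytope (N₁.disjointSum N₂ hd) ∧
        G = matroidPolytope N₁ + matroidPolytope N₂ := by
    rintro G ⟨N₁, N₂, hd, h1, h2, h3, h4, h5⟩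
    exact ⟨N₁, N₂, hd, h1, h2, h3, h4, h3.disjointSum h4 hd, h5,
      h5.trans (matroidPolytope_disjointSum hd)⟩
  rcases hR with rfl | rfl
  · obtain ⟨h1, h2, h3⟩ := hPQ.lower_face i
    exact ⟨h1, h2, key _ h3⟩
  · obtain ⟨h1, h2, h3⟩ := hPQ.upper_face i
    exact ⟨h1, h2, key _ h3⟩
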